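/- Proposition (local indeterminacy). Let $H\in(0,\infty)\setminus\mathbb{Z}$. There exists a constant $c(H)>0$, depending only on $H$, such that the following holds. Let $d\in\mathbb{N}$, let $W$ be a two-sided $d$-dimensional standard Brownian motion on a probability space $(\Omega,\mathcal{F},\mathbb{P})$, let $(\mathcal{F}_t)_{t\in\mathbb{R}}$ be the complete filtration generated by the increments of $W$ (that is, $\mathcal{F}_t$ is generated by all $W_v-W_u$ with $u\le v\le t$ and by the null events of $\mathcal{F}$), and write $\mathbf{E}^s=\mathbf{E}[\,\cdot\,|\mathcal{F}_s]$. Let $B^H$ be defined, for $t\ge 0$, as follows. If $H\in(0,1)$, $B^H$ is the fractional Brownian motion with almost surely continuous paths given by $$B^H_t=\int_{-\infty}^0\bigl(|t-r|^{H-1/2}-|r|^{H-1/2}\bigr)\,dW_r+\int_0^t|t-r|^{H-1/2}\,dW_r ,$$ the integrals being Wiener integrals. If $H>1$, $$B^H_t=\int_{0\le r_1\le\cdots\le r_{\lfloor H\rfloor}\le t}B^{H-\lfloor H\rfloor}_{r_1}\,dr_1\cdots dr_{\lfloor H\rfloor}.$$ Then for all $0\le s\le t\le 1$ the random variable $B^H_t$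 is square integrable and $$\mathbf{E}\bigl|B^H_t-\mathbf{E}^sB^H_t\bigr|^2=d\,c(H)\,|t-s|^{2H}.$$ Moreover, for $H>1$, $$c(H)=\frac{1}{2H}\Bigl(\prod_{i=1}^{\lfloor H\rfloor}\bigl(H-i+\tfrac12\bigr)\Bigr)^{-2}.$$ -/

import Mathlib

open MeasureTheory ProbabilityTheory Set Filter Topology

noncomputable section

namespace FractionalNoise

variable {Ω : Type*} [mΩ : MeasurableSpace Ω] {d : ℕ}

/-- `W` is a two-sided `d`-dimensional standard Brownian motion: it starts from `0`, has
independent increments over `ℝ`, `W t - W s` is a centred Gaussian vector with covariance matrix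
`(t - s) • 1`, and almost all paths are continuous. -/
structure IsTwoSidedBrownianMotion (W : ℝ → Ω → EuclideanSpace ℝ (Fin d)) (P : Measure Ω) :
    Prop where
  measurable : ∀ t, Measurable (W t)
  zero : ∀ᵐ ω ∂P, W 0 ω = 0
  indepIncrements : HasIndepIncrements W P
  hasLaw_increment : ∀ s t, s ≤ t →
    HasLaw (fun ω ↦ W t ω - W s ω)
      (multivariateGaussian 0 ((t - s) • (1 : Matrix (Fin d) (Fin d) ℝ))) P
  continuous_paths : ∀ᵐ ω ∂P, Continuous fun t ↦ W t ω

/-- The complete filtration generated by the increments of `W`: the `σ`-algebra at time `s` is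
generated by all `W v - W u`, `u ≤ v ≤ s`, together with all events of probability zero. -/
def incrementFiltration (W : ℝ → Ω → EuclideanSpace ℝ (Fin d)) (hW : ∀ t, Measurable (W t))
    (P : Measure Ω) : Filtration ℝ mΩ where
  seq s :=
    (⨆ p : {p : ℝ × ℝ // p.1 ≤ p.2 ∧ p.2 ≤ s},
      MeasurableSpace.comap (fun ω ↦ W p.1.2 ω - W p.1.1 ω) inferInstance) ⊔
    MeasurableSpace.generateFrom {A : Set Ω | MeasurableSet A ∧ P A = 0}
  mono' s t hst := by
    refine sup_le_sup (iSup_le fun p ↦ ?_) le_rfl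
    exact le_iSup (fun p : {p : ℝ × ℝ // p.1 ≤ p.2 ∧ p.2 ≤ t} ↦
      MeasurableSpace.comap (fun ω ↦ W p.1.2 ω - W p.1.1 ω) inferInstance)
      ⟨p.1, p.2.1, p.2.2.trans hst⟩
  le' s := by
    refine sup_le (iSup_le fun p ↦ ?_) (MeasurableSpace.generateFrom_le fun A hA ↦ hA.1)
    exact ((hW p.1.2).sub (hW p.1.1)).comap_le

/-- A deterministic step function `∑ i, coef i * 1_{(left i, right i]}` on the real line. -/
structure StepFunction where
  n : ℕ
  coef : Fin n → ℝ
  left : Fin n → ℝ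
  right : Fin n → ℝ
  left_le_right : ∀ i, left i ≤ right i

/-- The real function given by a step function. -/
def StepFunction.eval (φ : StepFunction) (r : ℝ) : ℝ :=
  ∑ i, (Ioc (φ.left i) (φ.right i)).indicator (fun _ ↦ φ.coef i) r

/-- The Wiener integral `∑ i, coef i • (W (right i) - W (left i))` of a step function. -/
def StepFunction.integral (φ : StepFunction) (W : ℝ → Ω → EuclideanSpace ℝ (Fin d)) (ω : Ω) :
    EuclideanSpace ℝ (Fin d) :=
  ∑ i, φ.coef i • (W (φ.right i) ω - W (φ.left i) ω)

/-- `X` is (a version of) the Wiener integral `∫_S f(r) dW_r`: `f` is square integrable on `S`, and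
`X` is the limit in `L²(P)` of the integrals of step functions converging to `f 1_S` in
`L²(ℝ)`. -/
def IsWienerIntegral (W : ℝ → Ω → EuclideanSpace ℝ (Fin d)) (P : Measure Ω) (S : Set ℝ)
    (f : ℝ → ℝ) (X : Ω → EuclideanSpace ℝ (Fin d)) : Prop :=
  MemLp (S.indicator f) 2 volume ∧ MemLp X 2 P ∧
    ∃ φ : ℕ → StepFunction,
      Tendsto (fun k ↦ eLpNorm (fun r ↦ S.indicator f r - (φ k).eval r) 2 volume) atTop (𝓝 0) ∧
      Tendsto (fun k ↦ eLpNorm (fun ω ↦ X ω - (φ k).integral W ω) 2 P) atTop (𝓝 0)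

/-- `B` is a fractional Brownian motion with Hurst parameter `H ∈ (0,1)` driven by `W`: for every
`t ≥ 0`, almost surely
`B_t = ∫_{-∞}^0 (|t-r|^{H-1/2} - |r|^{H-1/2}) dW_r + ∫_0^t |t-r|^{H-1/2} dW_r`
(Mandelbrot--van Ness), and almost all paths are continuous. -/
structure IsFractionalBrownianMotion (H : ℝ) (W : ℝ → Ω → EuclideanSpace ℝ (Fin d))
    (P : Measure Ω) (B : ℝ → Ω → EuclideanSpace ℝ (Fin d)) : Prop where
  representation : ∀ t, 0 ≤ t → ∃ X Y : Ω → EuclideanSpace ℝ (Fin d),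
    IsWienerIntegral W P (Iic 0) (fun r ↦ |t - r| ^ (H - 1 / 2) - |r| ^ (H - 1 / 2)) X ∧
    IsWienerIntegral W P (Ioc 0 t) (fun r ↦ |t - r| ^ (H - 1 / 2)) Y ∧
    ∀ᵐ ω ∂P, B t ω = X ω + Y ω
  continuous_paths : ∀ᵐ ω ∂P, ContinuousOn (fun t ↦ B t ω) (Ici 0)

/-- The iterated integral `∫_{0 ≤ r₁ ≤ ⋯ ≤ rₙ ≤ t} f(r₁) dr₁ ⋯ drₙ`, carried out successively in
`r₁, …, rₙ`; for `n = 0` it is `f t`. -/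
def iteratedIntegral (f : ℝ → EuclideanSpace ℝ (Fin d)) : ℕ → ℝ → EuclideanSpace ℝ (Fin d)
  | 0, t => f t
  | n + 1, t => ∫ r in (0 : ℝ)..t, iteratedIntegral f n r

/-- `B` is (a version of) the process `B^H` driven by `W`, for `H ∈ (0,∞) \ ℤ`: the
`⌊H⌋`-fold pathwise iterated integral of a fractional Brownian motion with Hurst parameter
`H - ⌊H⌋ ∈ (0,1)` driven by `W`. For `H < 1` it is this fractional Brownian motion itself. -/
def IsBH (H : ℝ) (W : ℝ → Ω → EuclideanSpace ℝ (Fin d)) (P : Measure Ω)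
    (B : ℝ → Ω → EuclideanSpace ℝ (Fin d)) : Prop :=
  ∃ β : ℝ → Ω → EuclideanSpace ℝ (Fin d), IsFractionalBrownianMotion (H - ⌊H⌋₊) W P β ∧
    ∀ t, 0 ≤ t → ∀ᵐ ω ∂P, B t ω = iteratedIntegral (fun r ↦ β r ω) ⌊H⌋₊ t

end FractionalNoise

end

noncomputable section

/-! For a Wiener integral `X = ∫ f dW`, conditioning on the past up to `s` removes exactly the noise
before `s`, so `E|X - E^s X|² = d ∫_s^∞ f²`. Thus only the kernel of `B^H_t` on `r > s ≥ 0` matters.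
There the Mandelbrot–van Ness kernel is just `(t - r)₊^(H - ⌊H⌋ - 1/2)`; its `⌊H⌋`-fold integral in
`t` is `(t - r)₊^(H - 1/2)` divided by the exponents met on the way, and squaring and integrating
gives the constant.

The Wiener integral is handled through its graph `wienerGraph`, the closed span in `L²(ℝ) × L²(P)`
of the pairs `(1_(a,b], W b - W a)`. Quadratic identities checked on these generators extend to the
graph by continuity (`norm_sq_eq_of_mem_closure_span`); this yields both the isometry and the
conditional variance formula (`norm_sq_sub_condExpL2`). As a closed subspace, the graph is stable
under Bochner integration in time. Identifying the two components of such an integral with pointwise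
integrals gives the stochastic Fubini theorem (`IsWienerProcess.primitive`), which carries
fractional Brownian motion to its iterated integrals. -/

namespace FractionalNoise

/-! ### Independence of the past, and conditional expectation of increments -/

/-- For a process with independent increments, all increments up to a time `s` are jointly
independent of any increment after `s`. -/
lemma indep_iSup_comap_sub {Ω E : Type*} {mΩ : MeasurableSpace Ω} {P : Measure Ω}
    [IsProbabilityMeasure P] [AddCommGroup E] [MeasurableSpace E] [MeasurableAdd₂ E]
    [MeasurableSub₂ E] {X : ℝ → Ω → E}
    (hX : HasIndepIncrements X P) (hm : ∀ t, Measurable (X t)) {s v : ℝ} (hsv : s ≤ v) :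
    Indep (⨆ u : Iic s, MeasurableSpace.comap (fun ω ↦ X s ω - X u ω) inferInstance)
      (MeasurableSpace.comap (fun ω ↦ X v ω - X s ω) inferInstance) P := by
  have hle (a b : ℝ) : MeasurableSpace.comap (fun ω ↦ X b ω - X a ω) inferInstance ≤ mΩ :=
    ((hm b).sub (hm a)).comap_le
  have heq : (⨆ u : Iic s, MeasurableSpace.comap (fun ω ↦ X s ω - X u ω) inferInstance) =
      ⨆ F : Finset (Iic s), ⨆ u ∈ F,
        MeasurableSpace.comap (fun ω ↦ X s ω - X (u : ℝ) ω) inferInstance :=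
    iSup_eq_iSup_finset _
  -- The family is infinite and its members are not mutually independent. Finite subfamilies form a
  -- directed system, and each is generated by consecutive increments of a sorted grid.
  rw [heq]
  refine indep_iSup_of_directed_le (fun F ↦ ?_) (fun F ↦ iSup₂_le fun u _ ↦ hle _ _) (hle _ _)
    (directed_of_isDirected_le fun F G hFG ↦ biSup_mono fun u hu ↦ Finset.mem_of_subset hFG hu)
  set G : Finset ℝ := F.map (Function.Embedding.subtype _) with hG
  set N := G.card
  have hGs : ∀ u ∈ G, u ≤ s := by
    intro u hu
    simp only [hG, Finset.mem_map, Function.Embedding.subtype_apply] at hu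
    obtain ⟨x, -, rfl⟩ := hu
    exact x.2
  -- The grid lists the `N` points of `G` in order, then `s` at index `N`, then `v` forever. Since
  -- `s` may belong to `G`, it is only weakly monotone.
  let τ : ℕ → ℝ := fun i ↦
    if h : i < N then G.orderEmbOfFin rfl ⟨i, h⟩ else if i = N then s else v
  have hτs : ∀ i, i < N → τ i ≤ s := fun i h ↦ by
    simp only [τ, h, dif_pos]
    exact hGs _ (Finset.orderEmbOfFin_mem _ _ _)
  have hτN : τ N = s := by simp [τ]
  have hτN' : τ (N + 1) = v := by simp [τ]
  have hmono : Monotone τ := by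
    refine monotone_nat_of_le_succ fun i ↦ ?_
    rcases lt_trichotomy (i + 1) N with h | h | h
    · have h' : i < N := by omega
      simp only [τ, h, h', dif_pos]
      exact (G.orderEmbOfFin rfl).monotone (by simp [Fin.le_def])
    · rw [h, hτN]; exact hτs i (by omega)
    · rcases Nat.eq_or_lt_of_le (Nat.lt_succ_iff.1 h) with h' | h'
      · rw [← h', hτN, hτN']; exact hsv
      · have h1 : ¬ i < N := by omega
        have h2 : ¬ i + 1 < N := by omega
        have h3 : i ≠ N := by omega
        have h4 : i + 1 ≠ N := by omega
        simp [τ, h1, h2, h3, h4]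
  have hind := hX.nat hmono
  have key := indep_iSup_of_disjoint (S := Iio N) (T := {N})
    (m := fun i ↦ MeasurableSpace.comap (fun ω ↦ X (τ (i + 1)) ω - X (τ i) ω) inferInstance)
    (fun i ↦ hle _ _) hind.iIndep (by simp)
  refine indep_of_indep_of_le_left (indep_of_indep_of_le_right key ?_) ?_
  · simp only [mem_singleton_iff, iSup_iSup_eq_left, hτN, hτN']
    exact le_rfl
  · refine iSup₂_le fun u hu ↦ ?_
    have huG : (u : ℝ) ∈ G := by simp [hG, hu, show (u : ℝ) ≤ s from u.2]
    obtain ⟨i, hi⟩ : ∃ i : Fin N, G.orderEmbOfFin rfl i = u := by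
      have : (u : ℝ) ∈ Set.range (G.orderEmbOfFin rfl) := by simpa using huG
      exact this
    have hτi : τ i = u := by simp [τ, hi]
    have hsum (ω : Ω) : X s ω - X u ω =
        ∑ j ∈ Finset.Ico (i : ℕ) N, (X (τ (j + 1)) ω - X (τ j) ω) := by
      rw [Finset.sum_Ico_sub (fun j ↦ X (τ j) ω) i.2.le, hτN, hτi]
    refine measurable_iff_comap_le.1 ?_
    simp_rw [hsum]
    refine Finset.measurable_fun_sum _ fun j hj ↦ ?_
    refine Measurable.mono (comap_measurable _) ?_ le_rfl
    exact le_iSup₂ (f := fun i (_ : i ∈ Iio N) ↦ MeasurableSpace.comap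
      (fun ω ↦ X (τ (i + 1)) ω - X (τ i) ω) inferInstance) j (Finset.mem_Ico.1 hj).2

/-- Independence is not affected by completing a `σ`-algebra by null events. -/
lemma Indep.eventuallyMeasurableSpace_left {Ω : Type*} {mΩ : MeasurableSpace Ω} {P : Measure Ω}
    {m m' : MeasurableSpace Ω} (h : Indep m m' P) :
    Indep (eventuallyMeasurableSpace m (ae P)) m' P := by
  rw [Indep_iff] at h ⊢
  rintro A B ⟨A', hA', hAA'⟩ hB
  rw [measure_congr hAA', ← h A' B hA' hB]
  exact measure_congr (hAA'.inter ae_eq_rfl)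

variable {Ω : Type*} [mΩ : MeasurableSpace Ω] {d : ℕ} {P : Measure Ω}
  {W : ℝ → Ω → EuclideanSpace ℝ (Fin d)}

lemma sub_measurable_incrementFiltration (hW : ∀ t, Measurable (W t)) {a b s : ℝ} (hab : a ≤ b)
    (hbs : b ≤ s) : Measurable[incrementFiltration W hW P s] (fun ω ↦ W b ω - W a ω) := by
  refine Measurable.mono (comap_measurable _) ?_ le_rfl
  exact le_sup_of_le_left (le_iSup (fun p : {p : ℝ × ℝ // p.1 ≤ p.2 ∧ p.2 ≤ s} ↦
      MeasurableSpace.comap (fun ω ↦ W p.1.2 ω - W p.1.1 ω) inferInstance)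
      ⟨(a, b), hab, hbs⟩)

/-- An increment over `[a, b]` with `b ≤ s` is `(W s - W a) - (W s - W b)`, so increments ending at
`s` generate the past; null events are absorbed by the completion. -/
lemma IsTwoSidedBrownianMotion.indep_incrementFiltration [IsProbabilityMeasure P]
    (hW : IsTwoSidedBrownianMotion W P)
    {s v : ℝ} (hsv : s ≤ v) :
    Indep (MeasurableSpace.comap (fun ω ↦ W v ω - W s ω) inferInstance)
      (incrementFiltration W hW.measurable P s) P := by
  refine indep_of_indep_of_le_right (Indep.eventuallyMeasurableSpace_left
    (indep_iSup_comap_sub hW.indepIncrements hW.measurable hsv)).symm ?_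
  refine sup_le (iSup_le fun p ↦ ?_) (MeasurableSpace.generateFrom_le fun A hA ↦ ?_)
  · refine le_trans ?_ le_eventuallyMeasurableSpace
    refine measurable_iff_comap_le.1 ?_
    have hm (u : ℝ) (hu : u ≤ s) :
        Measurable[⨆ u : Iic s, MeasurableSpace.comap (fun ω ↦ W s ω - W u ω) inferInstance]
          (fun ω ↦ W s ω - W u ω) :=
      Measurable.mono (comap_measurable _) (le_iSup (fun u : Iic s ↦
        MeasurableSpace.comap (fun ω ↦ W s ω - W u ω) inferInstance) ⟨u, hu⟩) le_rfl
    have h := (hm p.1.1 (p.2.1.trans p.2.2)).sub (hm p.1.2 p.2.2)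
    convert! h using 1
    ext1 ω
    simp
  · exact ⟨∅, @MeasurableSet.empty _ (_), ae_eq_empty.2 hA.2⟩

lemma IsTwoSidedBrownianMotion.memLp_sub (hW : IsTwoSidedBrownianMotion W P) (a b : ℝ) :
    MemLp (fun ω ↦ W b ω - W a ω) 2 P := by
  have key : ∀ a b, a ≤ b → MemLp (fun ω ↦ W b ω - W a ω) 2 P := fun a b hab ↦
    by
    have h := hW.hasLaw_increment a b hab
    refine MemLp.comp_of_map (g := id) ?_ h.aemeasurable
    rw [h.map_eq]
    exact IsGaussian.memLp_two_id
  rcases le_total a b with h | h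
  · exact key a b h
  · simpa [Pi.neg_def] using (key b a h).neg

lemma IsTwoSidedBrownianMotion.integral_sub_eq_zero (hW : IsTwoSidedBrownianMotion W P) {a b : ℝ}
    (hab : a ≤ b) : ∫ ω, (W b ω - W a ω) ∂P = 0 := by
  rw [(hW.hasLaw_increment a b hab).integral_eq]
  simp

lemma integral_norm_sq_multivariateGaussian (c : ℝ) (hc : 0 ≤ c) :
    ∫ x, ‖x‖ ^ 2 ∂(multivariateGaussian 0 (c • (1 : Matrix (Fin d) (Fin d) ℝ))) = d * c := by
  have hS : (c • (1 : Matrix (Fin d) (Fin d) ℝ)).PosSemidef :=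
    Matrix.PosSemidef.one.smul hc
  simp_rw [EuclideanSpace.norm_sq_eq]
  have hint : MemLp id 2 (multivariateGaussian 0 (c • (1 : Matrix (Fin d) (Fin d) ℝ))) :=
    IsGaussian.memLp_two_id
  have hL (i : Fin d) : MemLp (fun x : EuclideanSpace ℝ (Fin d) ↦ x i) 2
      (multivariateGaussian 0 (c • (1 : Matrix (Fin d) (Fin d) ℝ))) :=
    (EuclideanSpace.proj (𝕜 := ℝ) i).comp_memLp' hint
  have h1 (i : Fin d) : ∫ x, x i
      ∂(multivariateGaussian 0 (c • (1 : Matrix (Fin d) (Fin d) ℝ))) = 0 := by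
    have := (EuclideanSpace.proj (𝕜 := ℝ) i).integral_comp_comm
      (hint.integrable one_le_two)
    simpa using this
  rw [integral_finsetSum _ fun i _ ↦ by simpa using (hL i).integrable_norm_pow two_ne_zero]
  have h2 (i : Fin d) : ∫ x, ‖x i‖ ^ 2
      ∂(multivariateGaussian 0 (c • (1 : Matrix (Fin d) (Fin d) ℝ))) = c := by
    have hv := variance_eval_multivariateGaussian (μ := 0) hS i
    rw [variance_of_integral_eq_zero (hL i).aemeasurable (h1 i)] at hv
    simpa using hv
  rw [Finset.sum_congr rfl fun i _ ↦ h2 i]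
  simp

lemma IsTwoSidedBrownianMotion.integral_norm_sq_sub (hW : IsTwoSidedBrownianMotion W P)
    (a b : ℝ) : ∫ ω, ‖W b ω - W a ω‖ ^ 2 ∂P = d * |b - a| := by
  wlog hab : a ≤ b generalizing a b
  · rw [abs_sub_comm, ← this b a (le_of_not_ge hab)]
    simp_rw [norm_sub_rev]
  have := (hW.hasLaw_increment a b hab).integral_comp (f := fun x ↦ ‖x‖ ^ 2) (by fun_prop)
  simp only [Function.comp_def] at this
  rw [this, integral_norm_sq_multivariateGaussian _ (sub_nonneg.2 hab),
    abs_of_nonneg (sub_nonneg.2 hab)]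

/-- The conditional expectation of an increment of `W` is its part up to time `s`. -/
lemma IsTwoSidedBrownianMotion.condExp_sub [IsProbabilityMeasure P]
    (hW : IsTwoSidedBrownianMotion W P) {a b : ℝ}
    (hab : a ≤ b) (s : ℝ) :
    P[fun ω ↦ W b ω - W a ω | incrementFiltration W hW.measurable P s] =ᵐ[P]
      fun ω ↦ W (min b s) ω - W (min a s) ω := by
  have hle := (incrementFiltration W hW.measurable P).le s
  have hint (a b : ℝ) : Integrable (fun ω ↦ W b ω - W a ω) P :=
    (hW.memLp_sub a b).integrable one_le_two
  have h0 (v : ℝ) (hv : s ≤ v) :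
      P[fun ω ↦ W v ω - W s ω | incrementFiltration W hW.measurable P s] =ᵐ[P] fun _ ↦ 0 := by
    have := condExp_indep_eq ((hW.measurable v).sub (hW.measurable s)).comap_le hle
      (f := fun ω ↦ W v ω - W s ω) (comap_measurable _).stronglyMeasurable
      (hW.indep_incrementFiltration hv)
    rwa [hW.integral_sub_eq_zero hv] at this
  have h1 : P[fun ω ↦ W (min b s) ω - W (min a s) ω | incrementFiltration W hW.measurable P s] =
      fun ω ↦ W (min b s) ω - W (min a s) ω :=
    condExp_of_stronglyMeasurable hle (sub_measurable_incrementFiltration hW.measurable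
      (min_le_min_right s hab) (min_le_right _ _)).stronglyMeasurable (hint _ _)
  -- The increment is cut at `s`: the first summand is known at time `s`, the other two start at `s`
  -- and have zero conditional mean.
  have hdec : (fun ω ↦ W b ω - W a ω) = (fun ω ↦ W (min b s) ω - W (min a s) ω) +
      ((fun ω ↦ W (max b s) ω - W s ω) - fun ω ↦ W (max a s) ω - W s ω) := by
    ext1 ω
    simp only [Pi.add_apply, Pi.sub_apply]
    rcases le_total a s with ha | ha <;> rcases le_total b s with hb | hb <;> simp [ha, hb]
  rw [hdec]
  refine (condExp_add (hint _ _) ((hint _ _).sub (hint _ _)) _).trans ?_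
  filter_upwards [MeasureTheory.condExp_sub (hint s (max b s)) (hint s (max a s))
    (incrementFiltration W hW.measurable P s), h0 _ (le_max_right b s), h0 _ (le_max_right a s)]
    with ω h2 h3 h4
  rw [Pi.add_apply, h2, Pi.sub_apply, h3, h4, h1]
  simp

/-! ### The graph of the Wiener integral and the conditional variance -/

/-- Two continuous linear maps with proportional inner products on a set have proportional norms on
its closed linear span. -/
lemma norm_sq_eq_of_mem_closure_span {M F G : Type*} [NormedAddCommGroup M] [NormedSpace ℝ M]
    [NormedAddCommGroup F] [InnerProductSpace ℝ F] [NormedAddCommGroup G] [InnerProductSpace ℝ G]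
    (A : M →L[ℝ] F) (B : M →L[ℝ] G) (c : ℝ) {S : Set M}
    (h : ∀ x ∈ S, ∀ y ∈ S, inner ℝ (B x) (B y) = c * inner ℝ (A x) (A y)) {z : M}
    (hz : z ∈ (Submodule.span ℝ S).topologicalClosure) : ‖B z‖ ^ 2 = c * ‖A z‖ ^ 2 := by
  have hspan : ∀ x ∈ Submodule.span ℝ S, ∀ y ∈ Submodule.span ℝ S,
      inner ℝ (B x) (B y) = c * inner ℝ (A x) (A y) := by
    intro x hx y hy
    induction hx, hy using Submodule.span_induction₂ with
    | mem_mem x y hx hy => exact h x hx y hy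
    | zero_left | zero_right => simp
    | add_left x y z _ _ _ h1 h2 | add_right x y z _ _ _ h1 h2 =>
      simp [inner_add_left, inner_add_right, h1, h2, mul_add]
    | smul_left r x y _ _ h1 | smul_right r x y _ _ h1 =>
      simp only [map_smul, inner_smul_left, inner_smul_right, h1, conj_trivial]
      ring
  have hcl : IsClosed {z : M | ‖B z‖ ^ 2 = c * ‖A z‖ ^ 2} :=
    isClosed_eq (by fun_prop) (by fun_prop)
  refine closure_minimal (fun x hx ↦ ?_) hcl hz
  simpa [real_inner_self_eq_norm_sq] using hspan x hx x hx

/-- Recovers covariances of increments from `E|W v - W u|² = d |v - u|` alone; `abs_sub_overlap`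
then turns the four distances into the length of the overlap of the two intervals. -/
lemma real_inner_sub_sub_polarization {F : Type*} [NormedAddCommGroup F] [InnerProductSpace ℝ F]
    (a b a' b' : F) : 2 * inner ℝ (b - a) (b' - a') =
      ‖b - a'‖ ^ 2 + ‖a - b'‖ ^ 2 - ‖b - b'‖ ^ 2 - ‖a - a'‖ ^ 2 := by
  simp only [norm_sub_sq_real, inner_sub_left, inner_sub_right]
  ring

lemma abs_sub_overlap {a b a' b' : ℝ} (h : a ≤ b) (h' : a' ≤ b') :
    |b - a'| + |a - b'| - |b - b'| - |a - a'| = 2 * max (min b b' - max a a') 0 := by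
  grind

lemma volume_real_Ioc_inter (a b a' b' : ℝ) :
    volume.real (Ioc a b ∩ Ioc a' b') = max (min b b' - max a a') 0 := by
  rw [Ioc_inter_Ioc, Real.volume_real_Ioc]

lemma volume_real_Ioc_inter_restrict (a b a' b' s : ℝ) :
    (volume.restrict (Ioi s)).real (Ioc a b ∩ Ioc a' b') =
      max (min (max b s) (max b' s) - max (max a s) (max a' s)) 0 := by
  rw [measureReal_restrict_apply (measurableSet_Ioc.inter measurableSet_Ioc), Ioc_inter_Ioc,
    Ioc_inter_Ioi, Real.volume_real_Ioc]
  grind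

lemma volume_Ioc_ne_top {a b : ℝ} : volume (Ioc a b) ≠ ⊤ := by simp

lemma restrict_Ioc_ne_top {a b : ℝ} (s : ℝ) : (volume.restrict (Ioi s)) (Ioc a b) ≠ ⊤ :=
  ((Measure.restrict_apply_le _ _).trans_lt volume_Ioc_ne_top.lt_top).ne

/-- An increment of Brownian motion as an element of `L²`. -/
def IsTwoSidedBrownianMotion.increment (hW : IsTwoSidedBrownianMotion W P) (a b : ℝ) :
    Lp (EuclideanSpace ℝ (Fin d)) 2 P := (hW.memLp_sub a b).toLp

lemma IsTwoSidedBrownianMotion.increment_sub_increment (hW : IsTwoSidedBrownianMotion W P)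
    (r a b : ℝ) : hW.increment r b - hW.increment r a = hW.increment a b := by
  rw [increment, increment, increment, ← MemLp.toLp_sub]
  congr 1
  ext1 ω
  simp

lemma norm_toLp_sq {α E : Type*} [MeasurableSpace α] {μ : Measure α} [NormedAddCommGroup E]
    [InnerProductSpace ℝ E] {f : α → E} (hf : MemLp f 2 μ) :
    ‖hf.toLp f‖ ^ 2 = ∫ x, ‖f x‖ ^ 2 ∂μ := by
  rw [← real_inner_self_eq_norm_sq, L2.inner_def]
  refine integral_congr_ae ?_
  filter_upwards [hf.coeFn_toLp] with x hx
  rw [hx, real_inner_self_eq_norm_sq]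

lemma IsTwoSidedBrownianMotion.inner_increment (hW : IsTwoSidedBrownianMotion W P)
    {a b a' b' : ℝ} (h : a ≤ b) (h' : a' ≤ b') :
    inner ℝ (hW.increment a b) (hW.increment a' b') = d * max (min b b' - max a a') 0 := by
  have hn (u v : ℝ) : ‖hW.increment 0 v - hW.increment 0 u‖ ^ 2 = d * |v - u| := by
    rw [hW.increment_sub_increment, increment, norm_toLp_sq, hW.integral_norm_sq_sub]
  have := real_inner_sub_sub_polarization (hW.increment 0 a) (hW.increment 0 b)
    (hW.increment 0 a') (hW.increment 0 b')
  rw [hn, hn, hn, hn, hW.increment_sub_increment, hW.increment_sub_increment] at this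
  linear_combination (1 / 2) * this + (d / 2) * abs_sub_overlap h h'

/-- The pair consisting of the indicator of `(a, b]` and of its Wiener integral `W b - W a`. -/
def IsTwoSidedBrownianMotion.incrementPair (hW : IsTwoSidedBrownianMotion W P) (p : ℝ × ℝ) :
    Lp ℝ 2 (volume : Measure ℝ) × Lp (EuclideanSpace ℝ (Fin d)) 2 P :=
  (indicatorConstLp 2 (measurableSet_Ioc (a := p.1) (b := p.2)) volume_Ioc_ne_top (1 : ℝ),
    hW.increment p.1 p.2)

/-- The graph of the Wiener integral on `L²(ℝ)`. -/
def IsTwoSidedBrownianMotion.wienerGraph (hW : IsTwoSidedBrownianMotion W P) :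
    Submodule ℝ (Lp ℝ 2 (volume : Measure ℝ) × Lp (EuclideanSpace ℝ (Fin d)) 2 P) :=
  (Submodule.span ℝ (hW.incrementPair '' {p | p.1 ≤ p.2})).topologicalClosure

/-- The Wiener isometry. -/
lemma IsTwoSidedBrownianMotion.norm_sq_of_mem_wienerGraph (hW : IsTwoSidedBrownianMotion W P)
    {z : Lp ℝ 2 (volume : Measure ℝ) × Lp (EuclideanSpace ℝ (Fin d)) 2 P}
    (hz : z ∈ hW.wienerGraph) : ‖z.2‖ ^ 2 = d * ‖z.1‖ ^ 2 := by
  refine norm_sq_eq_of_mem_closure_span (ContinuousLinearMap.fst ℝ _ _)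
    (ContinuousLinearMap.snd ℝ _ _) d ?_ hz
  rintro _ ⟨⟨a, b⟩, h, rfl⟩ _ ⟨⟨a', b'⟩, h', rfl⟩
  simp only [ContinuousLinearMap.coe_fst', ContinuousLinearMap.coe_snd', incrementPair]
  rw [hW.inner_increment h h', L2.inner_indicatorConstLp_indicatorConstLp measurableSet_Ioc
    measurableSet_Ioc volume_Ioc_ne_top volume_Ioc_ne_top, volume_real_Ioc_inter]
  simp

lemma IsTwoSidedBrownianMotion.increment_sub_condExpL2 [IsProbabilityMeasure P]
    (hW : IsTwoSidedBrownianMotion W P) {a b : ℝ} (h : a ≤ b) (s : ℝ) :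
    hW.increment a b - (condExpL2 (EuclideanSpace ℝ (Fin d)) ℝ
      ((incrementFiltration W hW.measurable P).le s) (hW.increment a b) :
        Lp (EuclideanSpace ℝ (Fin d)) 2 P) = hW.increment (max a s) (max b s) := by
  ext1
  filter_upwards [Lp.coeFn_sub (hW.increment a b) (condExpL2 (EuclideanSpace ℝ (Fin d)) ℝ
      ((incrementFiltration W hW.measurable P).le s) (hW.increment a b) :
        Lp (EuclideanSpace ℝ (Fin d)) 2 P), (hW.memLp_sub a b).coeFn_toLp,
    (hW.memLp_sub (max a s) (max b s)).coeFn_toLp, hW.condExp_sub h s,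
    (hW.memLp_sub a b).condExpL2_ae_eq_condExp (𝕜 := ℝ)
      ((incrementFiltration W hW.measurable P).le s)] with ω h1 h2 h3 h4 h5
  rw [h1, Pi.sub_apply]
  unfold increment
  rw [h2, h3, h5, h4]
  rcases le_total a s with ha | ha <;> rcases le_total b s with hb | hb <;> simp [ha, hb]

/-- The conditional variance of a Wiener integral given the past up to time `s`. -/
lemma IsTwoSidedBrownianMotion.norm_sq_sub_condExpL2 [IsProbabilityMeasure P]
    (hW : IsTwoSidedBrownianMotion W P)
    {z : Lp ℝ 2 (volume : Measure ℝ) × Lp (EuclideanSpace ℝ (Fin d)) 2 P}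
    (hz : z ∈ hW.wienerGraph) (s : ℝ) :
    ‖z.2 - (condExpL2 (EuclideanSpace ℝ (Fin d)) ℝ
      ((incrementFiltration W hW.measurable P).le s) z.2 :
        Lp (EuclideanSpace ℝ (Fin d)) 2 P)‖ ^ 2 =
      d * ‖LpToLpRestrictCLM ℝ ℝ ℝ volume 2 (Ioi s) z.1‖ ^ 2 := by
  refine norm_sq_eq_of_mem_closure_span
    -- The two maps compared are restriction of the kernel to `(s, ∞)` and `id - E^s` on the
    -- integral. On generators, `id - E^s` truncates `(a, b]` to `(a ∨ s, b ∨ s]`.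
    ((LpToLpRestrictCLM ℝ ℝ ℝ volume 2 (Ioi s)).comp (ContinuousLinearMap.fst ℝ _ _))
    ((ContinuousLinearMap.id ℝ _ - (Submodule.subtypeL _).comp (condExpL2
      (EuclideanSpace ℝ (Fin d)) ℝ ((incrementFiltration W hW.measurable P).le s))).comp
    (ContinuousLinearMap.snd ℝ _ _)) d ?_ hz
  rintro _ ⟨⟨a, b⟩, h, rfl⟩ _ ⟨⟨a', b'⟩, h', rfl⟩
  have hind (a b : ℝ) : LpToLpRestrictCLM ℝ ℝ ℝ volume 2 (Ioi s)
      (indicatorConstLp 2 (measurableSet_Ioc (a := a) (b := b)) volume_Ioc_ne_top (1 : ℝ)) =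
      indicatorConstLp 2 (measurableSet_Ioc (a := a) (b := b))
        (restrict_Ioc_ne_top s) (1 : ℝ) := by
    refine Lp.ext ?_
    exact (LpToLpRestrictCLM_coeFn ℝ _ _).trans
      (EventuallyEq.trans (ae_restrict_of_ae indicatorConstLp_coeFn) indicatorConstLp_coeFn.symm)
  simp only [ContinuousLinearMap.comp_apply, ContinuousLinearMap.coe_fst',
    ContinuousLinearMap.coe_snd', incrementPair, _root_.sub_apply,
    ContinuousLinearMap.id_apply, Submodule.subtypeL_apply]
  rw [hW.increment_sub_condExpL2 h, hW.increment_sub_condExpL2 h', hind, hind,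
    hW.inner_increment (max_le_max_right s h) (max_le_max_right s h'),
    L2.inner_indicatorConstLp_indicatorConstLp measurableSet_Ioc measurableSet_Ioc
      (restrict_Ioc_ne_top s) (restrict_Ioc_ne_top s), volume_real_Ioc_inter_restrict]
  simp

lemma IsTwoSidedBrownianMotion.integral_norm_sq_sub_condExp [IsProbabilityMeasure P]
    (hW : IsTwoSidedBrownianMotion W P) {g : ℝ → ℝ} {X : Ω → EuclideanSpace ℝ (Fin d)}
    (hg : MemLp g 2 volume) (hX : MemLp X 2 P) (h : (hg.toLp g, hX.toLp X) ∈ hW.wienerGraph)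
    (s : ℝ) :
    ∫ ω, ‖X ω - (P[X | incrementFiltration W hW.measurable P s]) ω‖ ^ 2 ∂P =
      d * ∫ r in Ioi s, g r ^ 2 := by
  have hle := (incrementFiltration W hW.measurable P).le s
  have h1 := hW.norm_sq_sub_condExpL2 h s
  have h2 : LpToLpRestrictCLM ℝ ℝ ℝ volume 2 (Ioi s) (hg.toLp g) =
      (hg.restrict (Ioi s)).toLp g := by
    refine Lp.ext ?_
    exact (LpToLpRestrictCLM_coeFn ℝ _ _).trans
      (EventuallyEq.trans (ae_restrict_of_ae hg.coeFn_toLp) (MemLp.coeFn_toLp _).symm)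
  simp only [h2, norm_toLp_sq, Real.norm_eq_abs, sq_abs] at h1
  rw [← h1, ← real_inner_self_eq_norm_sq, L2.inner_def]
  refine integral_congr_ae ?_
  filter_upwards [hX.condExpL2_ae_eq_condExp (𝕜 := ℝ) hle, hX.coeFn_toLp,
    Lp.coeFn_sub (hX.toLp X) (condExpL2 (EuclideanSpace ℝ (Fin d)) ℝ hle (hX.toLp X) :
        Lp (EuclideanSpace ℝ (Fin d)) 2 P)] with ω h3 h4 h5
  rw [h5, Pi.sub_apply, h4, h3, real_inner_self_eq_norm_sq]

lemma coeFn_finsetSum_smul {α E ι : Type*} [MeasurableSpace α] {μ : Measure α}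
    [NormedAddCommGroup E] [NormedSpace ℝ E] (s : Finset ι) (c : ι → ℝ) (F : ι → Lp E 2 μ)
    {f : ι → α → E} (h : ∀ i, F i =ᵐ[μ] f i) :
    (∑ i ∈ s, c i • F i : Lp E 2 μ) =ᵐ[μ] fun x ↦ ∑ i ∈ s, c i • f i x := by
  classical
  induction s using Finset.induction_on with
  | empty => exact Lp.coeFn_zero E 2 μ
  | insert i s his ih =>
    rw [Finset.sum_insert his]
    filter_upwards [Lp.coeFn_add (c i • F i) (∑ i ∈ s, c i • F i), Lp.coeFn_smul (c i) (F i), ih,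
      h i] with x h1 h2 h3 h4
    rw [h1, Pi.add_apply, h2, h3, Pi.smul_apply, h4, Finset.sum_insert his]

lemma IsWienerIntegral.mem_wienerGraph (hW : IsTwoSidedBrownianMotion W P) {S : Set ℝ}
    {f : ℝ → ℝ} {X : Ω → EuclideanSpace ℝ (Fin d)} (h : IsWienerIntegral W P S f X) :
    (h.1.toLp (S.indicator f), h.2.1.toLp X) ∈ hW.wienerGraph := by
  obtain ⟨hf, hX, φ, h1, h2⟩ := h
  refine mem_closure_of_tendsto
    (f := fun k ↦ ∑ i, (φ k).coef i • hW.incrementPair ((φ k).left i, (φ k).right i))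
    (b := atTop) ?_ (Eventually.of_forall fun k ↦ Submodule.sum_mem _ fun i _ ↦
      Submodule.smul_mem _ _ (Submodule.subset_span ⟨_, (φ k).left_le_right i, rfl⟩))
  rw [Prod.tendsto_iff]
  simp only [Prod.fst_sum, Prod.snd_sum, Prod.smul_fst, Prod.smul_snd]
  rw [Lp.tendsto_Lp_iff_tendsto_eLpNorm', Lp.tendsto_Lp_iff_tendsto_eLpNorm']
  constructor
  · refine h1.congr fun k ↦ ?_
    rw [← eLpNorm_neg]
    refine eLpNorm_congr_ae ?_
    filter_upwards [hf.coeFn_toLp, coeFn_finsetSum_smul Finset.univ (φ k).coef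
      (fun i ↦ (hW.incrementPair ((φ k).left i, (φ k).right i)).1)
      (f := fun i ↦ (Ioc ((φ k).left i) ((φ k).right i)).indicator fun _ ↦ (1 : ℝ))
      (fun i ↦ indicatorConstLp_coeFn (hs := measurableSet_Ioc)
        (hμs := volume_Ioc_ne_top))] with x h3 h4
    rw [Pi.sub_apply, h3, h4, Pi.neg_apply, neg_sub, StepFunction.eval]
    congr 1
    refine Finset.sum_congr rfl fun i _ ↦ ?_
    by_cases hx : x ∈ Ioc ((φ k).left i) ((φ k).right i) <;> simp [hx]
  · refine h2.congr fun k ↦ ?_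
    rw [← eLpNorm_neg]
    refine eLpNorm_congr_ae ?_
    filter_upwards [hX.coeFn_toLp, coeFn_finsetSum_smul Finset.univ (φ k).coef
      (fun i ↦ (hW.incrementPair ((φ k).left i, (φ k).right i)).2)
      (f := fun i ω ↦ W ((φ k).right i) ω - W ((φ k).left i) ω)
      (fun i ↦ (hW.memLp_sub _ _).coeFn_toLp)] with x h3 h4
    rw [Pi.sub_apply, h3, h4, Pi.neg_apply, neg_sub, StepFunction.integral]

/-! ### Bochner integrals in L² as pointwise integrals -/

/-- The Riemann sum of `f` over the uniform subdivision of `[0, t]` into `n` intervals. -/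
def riemannSum {E : Type*} [AddCommGroup E] [Module ℝ E] (f : ℝ → E) (t : ℝ) (n : ℕ) : E :=
  ∑ i ∈ Finset.range n, (t / n) • f (t / n * i)

lemma tendsto_riemannSum {E : Type*} [NormedAddCommGroup E] [NormedSpace ℝ E]
    [CompleteSpace E] {f : ℝ → E} {t : ℝ} (ht : 0 ≤ t) (hf : ContinuousOn f (Icc 0 t)) :
    Tendsto (riemannSum f t) atTop (𝓝 (∫ u in (0 : ℝ)..t, f u)) := by
  rw [Metric.tendsto_atTop]
  intro ε hε
  have huc := isCompact_Icc.uniformContinuousOn_of_continuous hf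
  rw [Metric.uniformContinuousOn_iff] at huc
  -- Dividing by `t + 1` rather than `t` covers `t = 0` and makes the final bound strict.
  obtain ⟨δ, hδ, huc⟩ := huc (ε / (t + 1)) (by positivity)
  obtain ⟨N, hN⟩ := exists_nat_gt (t / δ)
  refine ⟨N + 1, fun n hn ↦ ?_⟩
  have hn0 : (0 : ℝ) < n := by exact_mod_cast (Nat.succ_pos N).trans_le hn
  have hNn : (N : ℝ) < n := by exact_mod_cast hn
  set h : ℝ := t / n with hh
  have hh0 : 0 ≤ h := by positivity
  have hnt : h * n = t := by rw [hh]; field_simp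
  have hhδ : h < δ := by
    rw [div_lt_iff₀ hδ] at hN
    rw [hh, div_lt_iff₀ hn0]
    nlinarith
  have hsub (i : ℕ) (hi : i < n) : Icc (h * i) (h * (i + 1 : ℕ)) ⊆ Icc 0 t := by
    refine Icc_subset_Icc (by positivity) ?_
    rw [← hnt]
    gcongr
    exact hi
  have hle (i : ℕ) : h * i ≤ h * (i + 1 : ℕ) := by
    gcongr
    simp
  have hint (i : ℕ) (hi : i < n) :
      IntervalIntegrable f volume (h * i) (h * (i + 1 : ℕ)) :=
    ContinuousOn.intervalIntegrable (by rw [uIcc_of_le (hle i)]; exact hf.mono (hsub i hi))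
  have hsum : ∫ u in (0 : ℝ)..t, f u =
      ∑ i ∈ Finset.range n, ∫ u in (h * i)..(h * (i + 1 : ℕ)), f u := by
    rw [intervalIntegral.sum_integral_adjacent_intervals (a := fun i : ℕ ↦ h * i) hint]
    simp [hnt]
  have hlen (i : ℕ) : h * (i + 1 : ℕ) - h * i = h := by push_cast; ring
  rw [dist_eq_norm, riemannSum, hsum, ← Finset.sum_sub_distrib]
  calc ‖∑ i ∈ Finset.range n, (h • f (h * i) - ∫ u in (h * i)..(h * (i + 1 : ℕ)), f u)‖
      ≤ ∑ i ∈ Finset.range n, ε / (t + 1) * h := by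
        refine norm_sum_le_of_le _ fun i hi ↦ ?_
        rw [Finset.mem_range] at hi
        have h1 : h • f (h * i) = ∫ u in (h * i)..(h * (i + 1 : ℕ)), f (h * i) := by
          rw [intervalIntegral.integral_const, hlen]
        rw [h1, ← intervalIntegral.integral_sub (by simp) (hint i hi)]
        refine (intervalIntegral.norm_integral_le_of_norm_le_const (C := ε / (t + 1))
          fun u hu ↦ ?_).trans_eq ?_
        · rw [uIoc_of_le (hle i)] at hu
          rw [← dist_eq_norm]
          refine (huc _ (hsub i hi ⟨le_rfl, hle i⟩) u (hsub i hi (Ioc_subset_Icc_self hu)) ?_).le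
          rw [Real.dist_eq, abs_sub_comm, abs_of_pos (sub_pos.2 hu.1)]
          linarith [hu.2, hlen i]
        · rw [hlen, abs_of_nonneg hh0]
    _ = ε / (t + 1) * t := by
        rw [Finset.sum_const, Finset.card_range, nsmul_eq_mul, ← hnt]; ring
    _ < ε := by
        rw [div_mul_eq_mul_div, div_lt_iff₀ (by positivity)]
        nlinarith

lemma coeFn_riemannSum {α E : Type*} [MeasurableSpace α] {μ : Measure α}
    [NormedAddCommGroup E] [NormedSpace ℝ E] {F : ℝ → Lp E 2 μ} {X : ℝ → α → E} {t : ℝ}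
    (ht : 0 ≤ t) (h : ∀ u, 0 ≤ u → F u =ᵐ[μ] X u) (n : ℕ) :
    (riemannSum F t n : Lp E 2 μ) =ᵐ[μ] fun x ↦ riemannSum (fun u ↦ X u x) t n :=
  coeFn_finsetSum_smul _ _ _ fun i ↦ h _ (by positivity)

/-- The Bochner integral in `L²` of a process with continuous paths is the pathwise integral. -/
lemma coeFn_intervalIntegral_of_continuous_paths {α E : Type*} [MeasurableSpace α] {μ : Measure α}
    [NormedAddCommGroup E] [NormedSpace ℝ E] [CompleteSpace E] {F : ℝ → Lp E 2 μ}
    {X : ℝ → α → E} {t : ℝ}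
    (ht : 0 ≤ t) (hF : ContinuousOn F (Icc 0 t)) (h : ∀ u, 0 ≤ u → F u =ᵐ[μ] X u)
    (hX : ∀ᵐ x ∂μ, ContinuousOn (fun u ↦ X u x) (Icc 0 t)) :
    (∫ u in (0 : ℝ)..t, F u : Lp E 2 μ) =ᵐ[μ] fun x ↦ ∫ u in (0 : ℝ)..t, X u x := by
  -- Riemann sums converge to the Bochner integral in `L²`, hence almost surely along a subsequence;
  -- for each continuous path they also converge to the pathwise integral.
  obtain ⟨ns, hns, hlim⟩ :=
    (tendstoInMeasure_of_tendsto_Lp (tendsto_riemannSum ht hF)).exists_seq_tendsto_ae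
  filter_upwards [hlim, hX, ae_all_iff.2 (coeFn_riemannSum ht h)] with x h1 h2 h3
  refine tendsto_nhds_unique h1 ?_
  simp_rw [h3]
  exact (tendsto_riemannSum ht h2).comp hns.tendsto_atTop

/-- The Bochner integral in `L²` of a jointly measurable family of functions is the pointwise
integral. -/
lemma coeFn_intervalIntegral_of_measurable {α : Type*} [MeasurableSpace α] {μ : Measure α}
    [SigmaFinite μ] {F : ℝ → Lp ℝ 2 μ} {k : ℝ → α → ℝ} {t : ℝ} (ht : 0 ≤ t)
    (hF : Continuous F) (h : ∀ u, 0 ≤ u → F u =ᵐ[μ] k u)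
    (hk : Measurable (Function.uncurry k)) :
    (∫ u in (0 : ℝ)..t, F u : Lp ℝ 2 μ) =ᵐ[μ] fun x ↦ ∫ u in (0 : ℝ)..t, k u x := by
  have hint (A : Set α) (hA : MeasurableSet A) (hμA : μ A < ⊤) :
      Integrable (Function.uncurry k) ((volume.restrict (Ioc 0 t)).prod (μ.restrict A)) := by
    rw [integrable_prod_iff hk.aestronglyMeasurable]
    constructor
    · refine (ae_restrict_mem measurableSet_Ioc).mono fun u hu ↦ ?_
      have : IntegrableOn (F u) A μ :=
        integrableOn_Lp_of_measure_ne_top _ fact_one_le_two_ennreal.elim hμA.ne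
      exact this.congr (ae_restrict_of_ae (h u hu.1.le))
    -- The integral of `|F u|` over `A` is an inner product with the indicator of `A`, hence
    -- continuous in `u`. This gives the joint integrability needed for Fubini.
    · have hcont : Continuous fun u ↦ inner ℝ (indicatorConstLp 2 hA hμA.ne (1 : ℝ)) |F u| := by
        exact continuous_const.inner (hF.sup hF.neg)
      refine (hcont.integrableOn_Ioc (a := 0) (b := t)).congr ?_
      refine (ae_restrict_mem measurableSet_Ioc).mono fun u hu ↦ ?_
      simp only
      rw [L2.inner_indicatorConstLp_one]
      refine integral_congr_ae (ae_restrict_of_ae ?_)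
      filter_upwards [Lp.coeFn_abs (F u), h u hu.1.le] with x h1 h2
      rw [h1, h2, Function.uncurry_apply_pair, Real.norm_eq_abs]
  refine ae_eq_of_forall_setIntegral_eq_of_sigmaFinite
    (fun A _ hμA ↦ integrableOn_Lp_of_measure_ne_top _ fact_one_le_two_ennreal.elim hμA.ne)
    (fun A hA hμA ↦ ?_) (fun A hA hμA ↦ ?_)
  · simp_rw [intervalIntegral.integral_of_le ht]
    exact (hint A hA hμA).integral_prod_right
  · rw [← L2.inner_indicatorConstLp_one (𝕜 := ℝ) hA hμA.ne]
    simp_rw [intervalIntegral.integral_of_le ht]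
    rw [← integral_integral_swap (hint A hA hμA), ← integral_inner (hF.integrableOn_Ioc)]
    refine setIntegral_congr_fun measurableSet_Ioc fun u hu ↦ ?_
    rw [L2.inner_indicatorConstLp_one]
    exact integral_congr_ae (ae_restrict_of_ae (h u hu.1.le))

lemma continuousOn_primitive_Ici {E : Type*} [NormedAddCommGroup E] [NormedSpace ℝ E]
    [CompleteSpace E] {f : ℝ → E} (hf : ContinuousOn f (Ici 0)) :
    ContinuousOn (fun t ↦ ∫ u in (0 : ℝ)..t, f u) (Ici 0) := by
  have hg : Continuous fun u ↦ f (max u 0) :=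
    hf.comp_continuous (by fun_prop) fun u ↦ le_max_right u 0
  refine (intervalIntegral.continuous_primitive (μ := volume)
    (fun a b ↦ hg.intervalIntegrable a b) 0).continuousOn.congr fun t ht ↦ ?_
  refine intervalIntegral.integral_congr fun u hu ↦ ?_
  rw [uIcc_of_le ht] at hu
  simp [hu.1]

lemma measurable_primitive {α : Type*} [MeasurableSpace α] {k : ℝ → α → ℝ}
    (hk : Measurable (Function.uncurry k)) :
    Measurable (Function.uncurry fun t x ↦ ∫ u in (0 : ℝ)..t, k u x) := by
  -- Rescaling to `(0, 1]` makes the domain independent of `t`, so measurability of parametric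
  -- integrals applies.
  have heq : (Function.uncurry fun t x ↦ ∫ u in (0 : ℝ)..t, k u x) =
      fun p ↦ p.1 • ∫ v in Ioc (0 : ℝ) 1, k (p.1 * v) p.2 := by
    ext1 p
    have := intervalIntegral.smul_integral_comp_mul_left (a := 0) (b := 1)
      (fun u ↦ k u p.2) p.1
    simp only [mul_zero, mul_one] at this
    rw [Function.uncurry, ← this, intervalIntegral.integral_of_le zero_le_one]
  rw [heq]
  refine measurable_fst.smul (StronglyMeasurable.measurable ?_)
  refine StronglyMeasurable.integral_prod_right (f := fun (p : ℝ × α) (v : ℝ) ↦ k (p.1 * v) p.2) ?_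
  refine Measurable.stronglyMeasurable ?_
  exact hk.comp (f := fun q : (ℝ × α) × ℝ ↦ (q.1.1 * q.2, q.1.2)) (by fun_prop)

/-! ### Stochastic Fubini -/

/-- `X` is a process with continuous paths and `X t = ∫ k t r dW_r` for `t ≥ 0`, where `k t`
depends continuously on `t` in `L²(ℝ)`. -/
structure IsWienerProcess (hW : IsTwoSidedBrownianMotion W P) (k : ℝ → ℝ → ℝ)
    (X : ℝ → Ω → EuclideanSpace ℝ (Fin d)) : Prop where
  measurable_kernel : Measurable (Function.uncurry k)
  continuous_paths : ∀ᵐ ω ∂P, ContinuousOn (fun t ↦ X t ω) (Ici 0)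
  exists_lift : ∃ F : ℝ → Lp ℝ 2 (volume : Measure ℝ) × Lp (EuclideanSpace ℝ (Fin d)) 2 P,
    Continuous F ∧ ∀ t, 0 ≤ t → F t ∈ hW.wienerGraph ∧ (F t).1 =ᵐ[volume] k t ∧ (F t).2 =ᵐ[P] X t

/-- Stochastic Fubini theorem. -/
lemma IsWienerProcess.primitive {hW : IsTwoSidedBrownianMotion W P} {k : ℝ → ℝ → ℝ}
    {X : ℝ → Ω → EuclideanSpace ℝ (Fin d)} (h : IsWienerProcess hW k X) :
    IsWienerProcess hW (fun t r ↦ ∫ u in (0 : ℝ)..t, k u r)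
      (fun t ω ↦ ∫ u in (0 : ℝ)..t, X u ω) := by
  obtain ⟨hk, hX, F, hF, hFm⟩ := h
  refine ⟨measurable_primitive hk, hX.mono fun ω ↦ continuousOn_primitive_Ici,
    fun t ↦ ∫ u in (0 : ℝ)..t, F u,
    intervalIntegral.continuous_primitive (fun a b ↦ hF.intervalIntegrable a b) 0,
    fun t ht ↦ ⟨?_, ?_, ?_⟩⟩
  · refine (Submodule.isClosed_topologicalClosure _).mem_of_tendsto
      (tendsto_riemannSum ht hF.continuousOn) (Eventually.of_forall fun n ↦ ?_)
    exact Submodule.sum_mem _ fun i _ ↦ Submodule.smul_mem _ _ (hFm _ (by positivity)).1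
  · have := (ContinuousLinearMap.fst ℝ (Lp ℝ 2 (volume : Measure ℝ))
      (Lp (EuclideanSpace ℝ (Fin d)) 2 P)).intervalIntegral_comp_comm
      (hF.intervalIntegrable (μ := volume) 0 t)
    simp only [ContinuousLinearMap.coe_fst'] at this
    rw [← this]
    exact coeFn_intervalIntegral_of_measurable ht (continuous_fst.comp hF)
      (fun u hu ↦ (hFm u hu).2.1) hk
  · have := (ContinuousLinearMap.snd ℝ (Lp ℝ 2 (volume : Measure ℝ))
      (Lp (EuclideanSpace ℝ (Fin d)) 2 P)).intervalIntegral_comp_comm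
      (hF.intervalIntegrable (μ := volume) 0 t)
    simp only [ContinuousLinearMap.coe_snd'] at this
    rw [← this]
    exact coeFn_intervalIntegral_of_continuous_paths ht (continuous_snd.comp hF).continuousOn
      (fun u hu ↦ (hFm u hu).2.2) (hX.mono fun ω hω ↦ hω.mono Icc_subset_Ici_self)

/-! ### The Mandelbrot–van Ness kernel and fractional Brownian motion -/

/-- The power `x ↦ x₊ ^ a` of the positive part. -/
def posPow (a x : ℝ) : ℝ := if 0 < x then x ^ a else 0

lemma measurable_posPow (a : ℝ) : Measurable (posPow a) :=
  Measurable.ite measurableSet_Ioi (by fun_prop) measurable_const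

lemma posPow_mul {h : ℝ} (hh : 0 < h) (a x : ℝ) : posPow a (h * x) = h ^ a * posPow a x := by
  unfold posPow
  by_cases hx : 0 < x
  · rw [if_pos hx, if_pos (mul_pos hh hx), Real.mul_rpow hh.le hx.le]
  · rw [if_neg hx, if_neg (fun h' ↦ hx (pos_of_mul_pos_right h' hh.le)), mul_zero]

lemma integral_posPow {a : ℝ} (ha : -1 < a) (t : ℝ) :
    ∫ x in (0 : ℝ)..t, posPow a x = posPow (a + 1) t / (a + 1) := by
  rcases le_or_gt t 0 with ht | ht
  · rw [posPow, if_neg ht.not_gt, zero_div, intervalIntegral.integral_symm,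
      intervalIntegral.integral_of_le ht, setIntegral_eq_zero_of_forall_eq_zero, neg_zero]
    exact fun x hx ↦ if_neg hx.2.not_gt
  · have : ∫ x in (0 : ℝ)..t, posPow a x = ∫ x in (0 : ℝ)..t, x ^ a := by
      rw [intervalIntegral.integral_of_le ht.le, intervalIntegral.integral_of_le ht.le]
      exact setIntegral_congr_fun measurableSet_Ioc fun x hx ↦ if_pos hx.1
    rw [this, integral_rpow (Or.inl ha), posPow, if_pos ht, Real.zero_rpow (by linarith), sub_zero]

lemma intervalIntegrable_posPow {a : ℝ} (ha : -1 < a) (s t : ℝ) :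
    IntervalIntegrable (posPow a) volume s t := by
  have h := intervalIntegral.intervalIntegrable_rpow' (a := s) (b := t) ha
  rw [intervalIntegrable_iff] at h ⊢
  refine (h.indicator (measurableSet_Ioi (a := (0 : ℝ)))).congr_fun (fun x _ ↦ ?_)
    measurableSet_uIoc
  simp [posPow, indicator_apply]

/-- The Mandelbrot--van Ness kernel. -/
def mvnKernel (a t r : ℝ) : ℝ := posPow a (t - r) - posPow a (-r)

lemma measurable_mvnKernel (a : ℝ) : Measurable (Function.uncurry (mvnKernel a)) :=
  ((measurable_posPow a).comp (measurable_fst.sub measurable_snd)).sub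
    ((measurable_posPow a).comp measurable_snd.neg)

lemma mvnKernel_ae_eq (a : ℝ) {t : ℝ} (ht : 0 ≤ t) :
    (fun r ↦ (Iic 0).indicator (fun r ↦ |t - r| ^ a - |r| ^ a) r +
      (Ioc 0 t).indicator (fun r ↦ |t - r| ^ a) r) =ᵐ[volume] mvnKernel a t := by
  filter_upwards [Measure.ae_ne volume 0, Measure.ae_ne volume t] with r h0 h1
  unfold mvnKernel posPow
  rcases lt_or_gt_of_ne h0 with h | h
  · have h2 : 0 < t - r := by linarith
    have h3 : r ∉ Ioc 0 t := fun h' ↦ h.not_gt h'.1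
    rw [indicator_of_mem (mem_Iic.2 h.le), indicator_of_notMem h3, if_pos h2,
      if_pos (neg_pos.2 h), abs_of_pos h2, abs_of_neg h, add_zero]
  · rw [indicator_of_notMem (fun h' ↦ h.not_ge (mem_Iic.1 h')), if_neg (by linarith : ¬ 0 < -r)]
    rcases lt_or_gt_of_ne h1 with h' | h'
    · have h2 : 0 < t - r := by linarith
      rw [indicator_of_mem (mem_Ioc.2 ⟨h, h'.le⟩), if_pos h2, abs_of_pos h2]
      simp
    · rw [indicator_of_notMem (fun h2 ↦ h'.not_ge h2.2), if_neg (by linarith : ¬ 0 < t - r)]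
      simp

lemma mvnKernel_sub (a u v r : ℝ) :
    mvnKernel a u r - mvnKernel a v r = mvnKernel a (u - v) (r - v) := by
  simp [mvnKernel]

lemma mvnKernel_scale (a : ℝ) {h : ℝ} (hh : 0 < h) (r : ℝ) :
    mvnKernel a h r = h ^ a * mvnKernel a 1 (r / h) := by
  have h1 : h - r = h * (1 - r / h) := by field_simp
  have h2 : -r = h * (-(r / h)) := by field_simp
  rw [mvnKernel, h1, h2, posPow_mul hh, posPow_mul hh, mvnKernel, mul_sub]

/-- Stationarity of increments (translation by `v`) and self-similarity (scaling by `u - v`) reduce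
every difference to the kernel at time `1`. -/
lemma integral_sq_mvnKernel_sub {a : ℝ} (ha : -1 / 2 < a) (u v : ℝ) :
    ∫ r, (mvnKernel a u r - mvnKernel a v r) ^ 2 =
      |u - v| ^ (2 * a + 1) * ∫ r, mvnKernel a 1 r ^ 2 := by
  wlog h : v ≤ u generalizing u v
  · rw [abs_sub_comm, ← this v u (le_of_not_ge h)]
    congr 1
    ext1 r
    ring
  rcases h.eq_or_lt with rfl | h
  · simp [Real.zero_rpow (by linarith : 2 * a + 1 ≠ 0)]
  have hh : 0 < u - v := sub_pos.2 h
  simp_rw [mvnKernel_sub]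
  rw [integral_sub_right_eq_self (fun r ↦ mvnKernel a (u - v) r ^ 2) v]
  simp_rw [mvnKernel_scale a hh, mul_pow]
  rw [integral_const_mul, Measure.integral_comp_div (fun r ↦ mvnKernel a 1 r ^ 2), smul_eq_mul,
    abs_of_pos hh, Real.rpow_add hh, Real.rpow_one, mul_comm 2 a, Real.rpow_mul hh.le]
  norm_cast
  ring

lemma IsFractionalBrownianMotion.exists_mem_wienerGraph {H : ℝ}
    {β : ℝ → Ω → EuclideanSpace ℝ (Fin d)} (hβ : IsFractionalBrownianMotion H W P β)
    (hW : IsTwoSidedBrownianMotion W P) {t : ℝ} (ht : 0 ≤ t) :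
    ∃ (h1 : MemLp (mvnKernel (H - 1 / 2) t) 2 volume) (h2 : MemLp (β t) 2 P),
      (h1.toLp _, h2.toLp _) ∈ hW.wienerGraph := by
  obtain ⟨X, Y, hX, hY, hB⟩ := hβ.representation t ht
  have hk := mvnKernel_ae_eq (H - 1 / 2) ht
  have hB' : X + Y =ᵐ[P] β t := EventuallyEq.symm hB
  refine ⟨(memLp_congr_ae hk).1 (hX.1.add hY.1), (memLp_congr_ae hB').1 (hX.2.1.add hY.2.1), ?_⟩
  have h := Submodule.add_mem _ (hX.mem_wienerGraph hW) (hY.mem_wienerGraph hW)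
  rw [Prod.mk_add_mk, ← MemLp.toLp_add, ← MemLp.toLp_add] at h
  convert h using 2
  · exact MemLp.toLp_congr _ _ hk.symm
  · exact MemLp.toLp_congr _ _ hB'.symm

/-- Kernel differences have squared norm proportional to `|u - v|^(2H)`, so the kernel is continuous
in `L²(ℝ)`; the isometry transfers this to `L²(P)`. -/
lemma IsFractionalBrownianMotion.isWienerProcess {H : ℝ} (hH : 0 < H)
    {β : ℝ → Ω → EuclideanSpace ℝ (Fin d)} (hβ : IsFractionalBrownianMotion H W P β)
    (hW : IsTwoSidedBrownianMotion W P) : IsWienerProcess hW (mvnKernel (H - 1 / 2)) β := by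
  refine ⟨measurable_mvnKernel _, hβ.continuous_paths, ?_⟩
  -- Freezing time at `0` for negative `t` makes the lift continuous on the whole line.
  choose hk hb hmem using fun t : ℝ ↦ hβ.exists_mem_wienerGraph hW (le_max_right t 0)
  let G : ℝ → Lp ℝ 2 (volume : Measure ℝ) × Lp (EuclideanSpace ℝ (Fin d)) 2 P :=
    fun t ↦ ((hk t).toLp _, (hb t).toLp _)
  have hGmem (t : ℝ) : G t ∈ hW.wienerGraph := hmem t
  set C := ∫ r, mvnKernel (H - 1 / 2) 1 r ^ 2
  have h1 (u v : ℝ) : ‖(G u).1 - (G v).1‖ ^ 2 = |max u 0 - max v 0| ^ (2 * H) * C := by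
    change ‖(hk u).toLp _ - (hk v).toLp _‖ ^ 2 = _
    rw [← MemLp.toLp_sub, norm_toLp_sq]
    simp only [Pi.sub_apply, Real.norm_eq_abs, sq_abs]
    rw [integral_sq_mvnKernel_sub (by linarith), show 2 * (H - 1 / 2) + 1 = 2 * H by ring]
  have h2 (u v : ℝ) : ‖(G u).2 - (G v).2‖ ^ 2 = d * ‖(G u).1 - (G v).1‖ ^ 2 :=
    hW.norm_sq_of_mem_wienerGraph (z := G u - G v) (Submodule.sub_mem _ (hGmem u) (hGmem v))
  have hlim (v : ℝ) : Tendsto (fun u ↦ |max u 0 - max v 0| ^ (2 * H) * C) (𝓝 v) (𝓝 0) := by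
    have hc : Continuous fun u ↦ |max u 0 - max v 0| ^ (2 * H) * C := by
      refine Continuous.mul (Continuous.rpow_const (by fun_prop) fun _ ↦ Or.inr ?_)
        continuous_const
      linarith
    simpa [Real.zero_rpow (by linarith : 2 * H ≠ 0)] using hc.tendsto v
  have hsq {ι : Type} {l : Filter ι} {f : ι → ℝ} (hf : ∀ i, 0 ≤ f i)
      (h : Tendsto (fun i ↦ f i ^ 2) l (𝓝 0)) : Tendsto f l (𝓝 0) := by
    have := (Real.continuous_sqrt.tendsto 0).comp h
    simpa [Function.comp_def, Real.sqrt_sq, hf] using this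
  refine ⟨G, continuous_iff_continuousAt.2 fun v ↦ ?_, fun t ht ↦ ?_⟩
  · refine ContinuousAt.prodMk (f := fun t ↦ (G t).1) (g := fun t ↦ (G t).2) ?_ ?_
    · refine tendsto_iff_norm_sub_tendsto_zero.2 (hsq (fun _ ↦ norm_nonneg _) ?_)
      simp_rw [h1]
      exact hlim v
    · refine tendsto_iff_norm_sub_tendsto_zero.2 (hsq (fun _ ↦ norm_nonneg _) ?_)
      simp_rw [h2, h1]
      simpa using (hlim v).const_mul (d : ℝ)
  · have hmax : max t 0 = t := max_eq_left ht
    exact ⟨hGmem t, (hk t).coeFn_toLp.trans (by rw [hmax]), (hb t).coeFn_toLp.trans (by rw [hmax])⟩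

/-! ### Iterated kernels and the constant -/

/-- The kernel of the iterated integrals of fractional Brownian motion. -/
def iteratedKernel (a : ℝ) : ℕ → ℝ → ℝ → ℝ
  | 0, t, r => mvnKernel a t r
  | n + 1, t, r => ∫ u in (0 : ℝ)..t, iteratedKernel a n u r

lemma IsFractionalBrownianMotion.isWienerProcess_iteratedIntegral {H : ℝ} (hH : 0 < H)
    {β : ℝ → Ω → EuclideanSpace ℝ (Fin d)} (hβ : IsFractionalBrownianMotion H W P β)
    (hW : IsTwoSidedBrownianMotion W P) (n : ℕ) :
    IsWienerProcess hW (iteratedKernel (H - 1 / 2) n)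
      (fun t ω ↦ iteratedIntegral (fun r ↦ β r ω) n t) := by
  induction n with
  | zero => exact hβ.isWienerProcess hH hW
  | succ n ih => exact ih.primitive

/-- For `r > 0` the term `posPow a (-r)` vanishes. Each integration then raises the exponent of `(t
- r)₊` by one and divides by the new exponent; the lower limit contributes nothing because `0 - r <
0`. -/
lemma iteratedKernel_of_pos {a : ℝ} (ha : -1 < a) {r : ℝ} (hr : 0 < r) (n : ℕ) (t : ℝ) :
    iteratedKernel a n t r =
      posPow (a + n) (t - r) / ∏ j ∈ Finset.range n, (a + (j + 1 : ℕ)) := by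
  induction n generalizing t with
  | zero => simp [iteratedKernel, mvnKernel, posPow, hr.not_gt]
  | succ n ih =>
    have hn : -1 < a + n := by
      have : (0 : ℝ) ≤ n := n.cast_nonneg
      linarith
    simp_rw [iteratedKernel, ih]
    rw [intervalIntegral.integral_div, intervalIntegral.integral_comp_sub_right
      (fun x ↦ posPow (a + n) x) r, ← intervalIntegral.integral_interval_sub_left
      (intervalIntegrable_posPow hn 0 _) (intervalIntegrable_posPow hn 0 _), integral_posPow hn,
      integral_posPow hn, Finset.prod_range_succ, posPow, posPow, posPow,
      if_neg (by linarith : ¬ 0 < 0 - r), zero_div, sub_zero, div_div, mul_comm]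
    push_cast
    simp only [add_assoc]

lemma setIntegral_sq_iteratedKernel {a : ℝ} (ha : -1 / 2 < a) (n : ℕ) {s t : ℝ} (hs : 0 ≤ s)
    (hst : s ≤ t) : ∫ r in Ioi s, iteratedKernel a n t r ^ 2 =
      (1 / ∏ j ∈ Finset.range n, (a + (j + 1 : ℕ))) ^ 2 *
        ((t - s) ^ (2 * (a + n) + 1) / (2 * (a + n) + 1)) := by
  have hn : -1 / 2 < a + n := by
    have : (0 : ℝ) ≤ n := n.cast_nonneg
    linarith
  have hker (r : ℝ) (hr : r ∈ Ioi s) : iteratedKernel a n t r ^ 2 =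
      (1 / ∏ j ∈ Finset.range n, (a + (j + 1 : ℕ))) ^ 2 * posPow (2 * (a + n)) (t - r) := by
    rw [iteratedKernel_of_pos (by linarith) (hs.trans_lt hr), div_pow, one_div, inv_pow,
      div_eq_inv_mul]
    congr 1
    unfold posPow
    split_ifs with h
    · rw [mul_comm 2 (a + n : ℝ), Real.rpow_mul h.le]
      norm_cast
    · simp
  rw [setIntegral_congr_fun measurableSet_Ioi hker, integral_const_mul]
  congr 1
  have hsub : ∫ r in Ioi s, posPow (2 * (a + n)) (t - r) =
      ∫ r in Ioc s t, posPow (2 * (a + n)) (t - r) := by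
    refine (setIntegral_eq_of_subset_of_forall_sdiff_eq_zero measurableSet_Ioi Ioc_subset_Ioi_self
      fun r hr ↦ if_neg fun h ↦ hr.2 ⟨hr.1, by linarith⟩)
  rw [hsub, ← intervalIntegral.integral_of_le hst,
    intervalIntegral.integral_comp_sub_left (fun x ↦ posPow (2 * (a + n)) x), sub_self,
    integral_posPow (by linarith), posPow]
  -- When `s = t`, `posPow` is `0` by definition, and the real power agrees because its exponent is
  -- nonzero.
  split_ifs with h
  · rfl
  · have : t - s = 0 := le_antisymm (not_lt.1 h) (sub_nonneg.2 hst)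
    rw [this, Real.zero_rpow (by linarith)]

/-- Reversal `j = n - i`, with `a + 1/2 + n` in the role of `H`. -/
lemma prod_hurst (a : ℝ) (n : ℕ) :
    ∏ i ∈ Finset.Icc 1 n, (a + 1 / 2 + n - (i : ℝ) + 1 / 2) =
      ∏ j ∈ Finset.range n, (a + (j + 1 : ℕ)) := by
  refine Finset.prod_nbij' (fun i ↦ n - i) (fun j ↦ n - j) ?_ ?_ ?_ ?_ fun i hi ↦ ?_
  iterate 4 simp only [Finset.mem_Icc, Finset.mem_range]; omega
  rw [Finset.mem_Icc] at hi
  push_cast [hi.2]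
  ring

end FractionalNoise

end

theorem mainTheorem4 (H : ℝ) (hH : 0 < H) (hHZ : ∀ n : ℤ, H ≠ n) :
    ∃ c : ℝ, 0 < c ∧
      (1 < H → c = 1 / (2 * H) * (1 / ∏ i ∈ Finset.Icc 1 ⌊H⌋₊, (H - (i : ℝ) + 1 / 2)) ^ 2) ∧
      ∀ (d : ℕ) (Ω : Type*) [MeasurableSpace Ω] (P : Measure Ω) [IsProbabilityMeasure P]
        (W B : ℝ → Ω → EuclideanSpace ℝ (Fin d))
        (hW : FractionalNoise.IsTwoSidedBrownianMotion W P),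
        FractionalNoise.IsBH H W P B →
        ∀ s t : ℝ, 0 ≤ s → s ≤ t → t ≤ 1 →
          MemLp (B t) 2 P ∧
          ∫ ω, ‖B t ω -
              (P[B t | FractionalNoise.incrementFiltration W hW.measurable P s]) ω‖ ^ 2 ∂P =
            (d : ℝ) * c * |t - s| ^ (2 * H) := by
  -- Non-integrality makes the Hurst parameter `H - ⌊H⌋` strictly positive.
  have hfl : (⌊H⌋₊ : ℝ) < H :=
    lt_of_le_of_ne (Nat.floor_le hH.le) fun h ↦ hHZ ⌊H⌋₊ (by exact_mod_cast h.symm)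
  set n := ⌊H⌋₊
  have hprod : 0 < ∏ i ∈ Finset.Icc 1 n, (H - (i : ℝ) + 1 / 2) := by
    refine Finset.prod_pos fun i hi ↦ ?_
    have : (i : ℝ) ≤ n := by exact_mod_cast (Finset.mem_Icc.1 hi).2
    linarith
  -- The same formula serves `H < 1`, where the product is empty and `c = 1 / (2H)`.
  refine ⟨1 / (2 * H) * (1 / ∏ i ∈ Finset.Icc 1 n, (H - (i : ℝ) + 1 / 2)) ^ 2, by positivity,
    fun _ ↦ rfl, ?_⟩
  intro d Ω _ P _ W B hW ⟨β, hβ, hB⟩ s t hs hst _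
  have ht : 0 ≤ t := hs.trans hst
  obtain ⟨-, -, F, -, hF⟩ :=
    hβ.isWienerProcess_iteratedIntegral (sub_pos.2 hfl) hW n
  obtain ⟨hmem, hF1, hF2⟩ := hF t ht
  have hFB : (F t).2 =ᵐ[P] B t := hF2.trans (EventuallyEq.symm (hB t ht))
  have hk := (memLp_congr_ae hF1).1 (Lp.memLp (F t).1)
  have hX : MemLp (B t) 2 P := (memLp_congr_ae hFB).1 (Lp.memLp (F t).2)
  have hpair : (hk.toLp _, hX.toLp _) ∈ hW.wienerGraph := by
    have heq : (hk.toLp _, hX.toLp _) = F t := Prod.ext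
      (Lp.ext (hk.coeFn_toLp.trans hF1.symm)) (Lp.ext (hX.coeFn_toLp.trans hFB.symm))
    rwa [heq]
  refine ⟨hX, ?_⟩
  rw [hW.integral_norm_sq_sub_condExp hk hX hpair s,
    FractionalNoise.setIntegral_sq_iteratedKernel (by linarith) n hs hst,
    ← FractionalNoise.prod_hurst, abs_of_nonneg (sub_nonneg.2 hst)]
  have h1 : 2 * (H - n - 1 / 2 + n) + 1 = 2 * H := by ring
  have h2 (i : ℕ) : H - n - 1 / 2 + 1 / 2 + n - (i : ℝ) + 1 / 2 = H - i + 1 / 2 := by ring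
  simp_rw [h1, h2]
  ring
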